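/- **Theorem.** Let $n\in\mathbb N$, let $x_1,\dots,x_n\in\mathbb C\setminus\{0\}$, let \[L_+=\{(e_1,\dots,e_n)\in\mathbb Z^n : e_1x_1+\cdots+e_nx_n=0\},\] and let $M\in\mathbb Q$ be such that $L_+$ has a $\mathbb Z$-basis consisting of vectors $b$ with $\|b\|_\infty\le M$. Consider the following algorithm, which accesses the $x_i$ only through rational approximations and through the test whether a given $e\in\mathbb Z^n$ lies in $L_+$. 1. Set $w\leftarrow 1$ and let $B$ be the set of the first $n$ unit vectors of $\mathbb Z^{n+2}$. 2. While some $(e_1,\dots,e_n,*,*)\in B$ has $(e_1,\dots,e_n)\notin L_+$, do the following: (a) $w\leftarrow 2w$; (b) find $\xi_1,\dots,\xi_n\in\mathbb Q(\mathrm i)$ with $|\operatorname{Re}\xi_i-\operatorname{Re}x_i|<\frac1{nw}$ and $|\operatorname{Im}\xi_i-\operatorname{Im}x_i|<\frac1{nw}$ for all $i$; (c) replace every $(e_1,\dots,e_n,*,*)\in B$ by $\bigl(e_1,\dots,e_n,\,w\sum_i e_i\operatorname{Re}\xi_i,\,w\sum_i e_i\operatorname{Im}\xi_i\bigr)$; (d)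 apply LLL to $B$, that is, take an LLL-reduced basis $b_1,\dots,b_r$ (with the usual parameter $3/4$) of the lattice generated by $B$; let $\bar b_1,\dots,\bar b_r$ be its Gram–Schmidt vectors; (e) while $r>0$ and $\|\bar b_r\|>\sqrt{n+2}\,M$, set $r\leftarrow r-1$; (f) set $B\leftarrow\{b_1,\dots,b_r\}$. 3. Return $\{(e_1,\dots,e_n):(e_1,\dots,e_n,*,*)\in B\}$. This algorithm is correct and terminates. More precisely, whatever approximations $\xi_i$ are chosen in (b) and whatever LLL-reduced bases are taken in (d): whenever the body of the main loop is entered, it can be carried out (the required approximations and the LLL-reduced basis exist); the main loop is executed only finitely often; and the set that is returned is a $\mathbb Z$-basis of $L_+$. -/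

import Mathlib

noncomputable section

namespace IntegerRelation

open InnerProductSpace

/-- The lattice `L₊` of integer relations `e₁ x₁ + ⋯ + eₙ xₙ = 0`. -/
def relationLattice {n : ℕ} (x : Fin n → ℂ) : Submodule ℤ (Fin n → ℤ) where
  carrier := {e | ∑ i, (e i : ℂ) * x i = 0}
  zero_mem' := by simp
  add_mem' := by
    intro a b ha hb
    simp only [Set.mem_ofPred_eq] at ha hb ⊢
    simp [add_mul, Finset.sum_add_distrib, ha, hb]
  smul_mem' := by
    intro c a ha
    simp only [Set.mem_ofPred_eq] at ha ⊢
    simp [mul_assoc, ← Finset.mul_sum, ha]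

/-- `S` is a basis of the lattice `L`: a linearly independent set of generators. -/
def IsLatticeBasis {n : ℕ} (L : Submodule ℤ (Fin n → ℤ)) (S : Set (Fin n → ℤ)) : Prop :=
  LinearIndepOn ℤ id S ∧ Submodule.span ℤ S = L

/-- The Gram-Schmidt coefficient `μ i j = ⟪bᵢ, b̄ⱼ⟫ / ‖b̄ⱼ‖²`. -/
def gsCoeff {E : Type*} [NormedAddCommGroup E] [InnerProductSpace ℝ E] {m : ℕ}
    (b : Fin m → E) (i j : Fin m) : ℝ :=
  inner ℝ (b i) (gramSchmidt ℝ b j) / ‖gramSchmidt ℝ b j‖ ^ 2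

/-- LLL-reduced families (Lenstra, Lenstra and Lovász, with the usual parameter `3/4`):
linearly independent, size-reduced, and subject to the Lovász condition. -/
structure IsLLLReduced {E : Type*} [NormedAddCommGroup E] [InnerProductSpace ℝ E] {m : ℕ}
    (b : Fin m → E) : Prop where
  linearIndependent : LinearIndependent ℝ b
  sizeReduced : ∀ i j : Fin m, j < i → |gsCoeff b i j| ≤ 1 / 2
  lovasz : ∀ i j : Fin m, (j : ℕ) + 1 = i →
    3 / 4 * ‖gramSchmidt ℝ b j‖ ^ 2
      ≤ ‖gramSchmidt ℝ b i + gsCoeff b i j • gramSchmidt ℝ b j‖ ^ 2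

/-- The vectors `(e₁, …, eₙ, s, t)` the algorithm works with: `eᵢ` integers, `s`, `t` rational. -/
abbrev Vec (n : ℕ) : Type := (Fin n → ℤ) × ℚ × ℚ

/-- A vector `(e₁, …, eₙ, s, t)` as a point of Euclidean space of dimension `n + 2`. -/
def vecToEuclidean {n : ℕ} (v : Vec n) : EuclideanSpace ℝ (Fin n ⊕ Fin 2) :=
  WithLp.toLp 2 (Sum.elim (fun i => (v.1 i : ℝ)) ![(v.2.1 : ℝ), (v.2.2 : ℝ)])

/-- `b₁, …, bₘ` is an admissible result of applying LLL to `B`: an LLL-reduced basis of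
the lattice generated by `B`. -/
def IsLLLOutput {n : ℕ} (B : Set (Vec n)) {m : ℕ} (b : Fin m → Vec n) : Prop :=
  Submodule.span ℤ (Set.range b) = Submodule.span ℤ B ∧ IsLLLReduced (fun i => vecToEuclidean (b i))

open Classical in
/-- The inner loop, started at `r`: as long as `r > 0` and the `r`-th Gram-Schmidt vector
(which has index `r - 1` in `Fin m`) is longer than `bound`, decrease `r` by one. -/
def removeLong {E : Type*} [NormedAddCommGroup E] [InnerProductSpace ℝ E] {m : ℕ}
    (b : Fin m → E) (bound : ℝ) : ℕ → ℕ
  | 0 => 0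
  | r + 1 =>
    if ∃ h : r < m, bound < ‖gramSchmidt ℝ b ⟨r, h⟩‖ then removeLong b bound r else r + 1

/-- The values of the program variables `w` and `B` at the head of the main loop. -/
structure State (n : ℕ) where
  w : ℕ
  B : Set (Vec n)

/-- `w ← 1`, and `B` consists of the first `n` unit vectors. -/
def State.init (n : ℕ) : State n where
  w := 1
  B := Set.range fun i : Fin n => (Pi.single i 1, 0, 0)

/-- The condition of the main loop: some `(e₁, …, eₙ, ∗, ∗)` in `B` has `(e₁, …, eₙ) ∉ L₊`. -/
def LoopCond {n : ℕ} (x : Fin n → ℂ) (s : State n) : Prop :=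
  ∃ v ∈ s.B, v.1 ∉ relationLattice x

/-- The Gaussian rationals `ξᵢ = re i + im i * I` approximate the `xᵢ` to within `1 / (n w)`,
in the real and in the imaginary part. -/
def IsApprox {n : ℕ} (x : Fin n → ℂ) (w : ℕ) (re im : Fin n → ℚ) : Prop :=
  ∀ i, |(re i : ℝ) - (x i).re| < 1 / ((n : ℝ) * w) ∧ |(im i : ℝ) - (x i).im| < 1 / ((n : ℝ) * w)

/-- Replace `(e₁, …, eₙ, ∗, ∗)` by `(e₁, …, eₙ, w ∑ eᵢ Re ξᵢ, w ∑ eᵢ Im ξᵢ)`. -/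
def replaceVec {n : ℕ} (w : ℕ) (re im : Fin n → ℚ) (v : Vec n) : Vec n :=
  (v.1, (w : ℚ) * ∑ i, (v.1 i : ℚ) * re i, (w : ℚ) * ∑ i, (v.1 i : ℚ) * im i)

/-- `s'` can result from `s` by one execution of the body of the main loop. The choice of the
approximations and of the LLL-reduced basis is left open. -/
def Step {n : ℕ} (x : Fin n → ℂ) (M : ℚ) (s s' : State n) : Prop :=
  LoopCond x s ∧ s'.w = 2 * s.w ∧
    ∃ re im : Fin n → ℚ, IsApprox x s'.w re im ∧
      ∃ (m : ℕ) (b : Fin m → Vec n), IsLLLOutput (replaceVec s'.w re im '' s.B) b ∧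
        s'.B = {v | ∃ i : Fin m,
          (i : ℕ) < removeLong (fun i => vecToEuclidean (b i)) (Real.sqrt ((n : ℝ) + 2) * M) m ∧
            v = b i}

/-- The states that occur at the head of the main loop in some run of the algorithm. -/
def Reachable {n : ℕ} (x : Fin n → ℂ) (M : ℚ) (s : State n) : Prop :=
  Relation.ReflTransGen (Step x M) (State.init n) s

/-- What is returned when the main loop is left: the vectors of `B` without their last two
coordinates. -/
def State.output {n : ℕ} (s : State n) : Set (Fin n → ℤ) :=
  Prod.fst '' s.B

end IntegerRelation

end

/-! After step (c) the last two coordinates of a lattice vector are determined by its integer part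
(`replaceVec_eq_self_of_mem`). Hence balls contain only finitely many lattice vectors, and an
LLL-reduced basis exists by a minimality argument (`exists_isLLLReduced`).

Correctness rests on `Invariant`: the integer parts of `B` stay independent and their span contains
`L₊`. A relation of height at most `M` lifts to a lattice vector of norm at most `√(n+2) * M`, and
such a vector has coefficient zero at every basis vector that the inner loop drops
(`coeff_eq_zero_of_norm_le`). When the main loop is left, the span also lies inside `L₊`.

Termination: in a reduced basis, a short last kept Gram-Schmidt vector bounds all kept basis vectors
by some `K` independent of `w` (`IsLLLReduced.norm_le`). So only finitely many integer parts `e` can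
occur, and each non-relation among them violates `w * |∑ eᵢ xᵢ| ≤ 4 * K` once `w` is large
(`eventually_not_loopCond`). -/

namespace IntegerRelation

open InnerProductSpace

/-! ### Gram-Schmidt vectors and size reduction -/

section GramSchmidt

variable {E : Type*} [NormedAddCommGroup E] [InnerProductSpace ℝ E] {m : ℕ}

lemma inner_gramSchmidt_eq_zero_of_mem_span (b : Fin m → E) (j : Fin m) {u : E}
    (hu : u ∈ Submodule.span ℝ (b '' Set.Iio j)) : inner ℝ (gramSchmidt ℝ b j) u = 0 := by
  induction hu using Submodule.span_induction with
  | mem x hx =>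
    obtain ⟨i, hi, rfl⟩ := hx
    exact gramSchmidt_inv_triangular ℝ b hi
  | zero => simp
  | add x y _ _ hx hy => rw [inner_add_right, hx, hy, add_zero]
  | smul a x _ hx => rw [inner_smul_right, hx, mul_zero]

lemma self_sub_gramSchmidt_mem_span (b : Fin m → E) (j : Fin m) :
    b j - gramSchmidt ℝ b j ∈ Submodule.span ℝ (b '' Set.Iio j) := by
  rw [← span_gramSchmidt_Iio ℝ b j]
  nth_rw 1 [gramSchmidt_def'' ℝ b j]
  rw [add_sub_cancel_left]
  refine Submodule.sum_mem _ fun i hi => Submodule.smul_mem _ _ (Submodule.subset_span ?_)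
  exact ⟨i, by simpa using hi, rfl⟩

/-- The difference of the two Gram-Schmidt vectors lies in the common span of the predecessors and
is orthogonal to it. -/
lemma gramSchmidt_congr {b c : Fin m → E} {j : Fin m}
    (hspan : Submodule.span ℝ (c '' Set.Iio j) = Submodule.span ℝ (b '' Set.Iio j))
    (hsub : c j - b j ∈ Submodule.span ℝ (b '' Set.Iio j)) :
    gramSchmidt ℝ c j = gramSchmidt ℝ b j := by
  have hc := self_sub_gramSchmidt_mem_span c j
  rw [hspan] at hc
  have hd : gramSchmidt ℝ c j - gramSchmidt ℝ b j ∈ Submodule.span ℝ (b '' Set.Iio j) := by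
    have := Submodule.sub_mem _ (Submodule.add_mem _ hsub (self_sub_gramSchmidt_mem_span b j)) hc
    convert this using 1
    abel
  have h1 := inner_gramSchmidt_eq_zero_of_mem_span b j hd
  have h2 := inner_gramSchmidt_eq_zero_of_mem_span c j (hspan ▸ hd)
  rw [← sub_eq_zero, ← inner_self_eq_zero (𝕜 := ℝ), inner_sub_left, h1, h2, sub_zero]

/-- By Pythagoras, the Gram-Schmidt vector is the shortest element of its coset modulo the span of
the predecessors. -/
lemma norm_gramSchmidt_le_of_sub_mem (b : Fin m → E) (j : Fin m) {v : E}
    (hv : b j - v ∈ Submodule.span ℝ (b '' Set.Iio j)) : ‖gramSchmidt ℝ b j‖ ≤ ‖v‖ := by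
  have h : v - gramSchmidt ℝ b j ∈ Submodule.span ℝ (b '' Set.Iio j) := by
    have := Submodule.sub_mem _ (self_sub_gramSchmidt_mem_span b j) hv
    convert this using 1
    abel
  have h0 := inner_gramSchmidt_eq_zero_of_mem_span b j h
  have h1 := norm_add_sq_real (gramSchmidt ℝ b j) (v - gramSchmidt ℝ b j)
  rw [add_sub_cancel, h0] at h1
  have h2 : ‖gramSchmidt ℝ b j‖ ^ 2 ≤ ‖v‖ ^ 2 := by
    nlinarith [sq_nonneg ‖v - gramSchmidt ℝ b j‖]
  exact le_of_sq_le_sq h2 (norm_nonneg _)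

lemma inner_self_gramSchmidt (b : Fin m → E) (j : Fin m) :
    inner ℝ (b j) (gramSchmidt ℝ b j) = ‖gramSchmidt ℝ b j‖ ^ 2 := by
  have h := inner_gramSchmidt_eq_zero_of_mem_span b j (self_sub_gramSchmidt_mem_span b j)
  rw [inner_sub_right, sub_eq_zero, real_inner_self_eq_norm_sq] at h
  rw [real_inner_comm, h]

lemma self_eq_gramSchmidt_add_sum (b : Fin m → E) (i : Fin m) :
    b i = gramSchmidt ℝ b i + ∑ j ∈ Finset.Iio i, gsCoeff b i j • gramSchmidt ℝ b j := by
  nth_rw 1 [gramSchmidt_def'' ℝ b i]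
  simp only [gsCoeff, real_inner_comm, RCLike.ofReal_real_eq_id, id_eq]

lemma norm_le_of_sizeReduced {b : Fin m → E} {i : Fin m} {C : ℝ}
    (hμ : ∀ j < i, |gsCoeff b i j| ≤ 1 / 2) (hC : ∀ j ≤ i, ‖gramSchmidt ℝ b j‖ ≤ C) :
    ‖b i‖ ≤ m * C := by
  have hC0 : 0 ≤ C := (norm_nonneg _).trans (hC i le_rfl)
  calc ‖b i‖ ≤ ‖gramSchmidt ℝ b i‖
        + ∑ j ∈ Finset.Iio i, ‖gsCoeff b i j • gramSchmidt ℝ b j‖ := by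
        nth_rw 1 [self_eq_gramSchmidt_add_sum b i]
        exact (norm_add_le _ _).trans (by gcongr; exact norm_sum_le _ _)
    _ ≤ C + ∑ j ∈ Finset.Iio i, C := by
        gcongr with j hj
        · exact hC i le_rfl
        · have hj := Finset.mem_Iio.1 hj
          rw [norm_smul, Real.norm_eq_abs]
          have := hμ j hj
          nlinarith [hC j hj.le, norm_nonneg (gramSchmidt ℝ b j), abs_nonneg (gsCoeff b i j)]
    _ = ((i : ℕ) + 1 : ℝ) * C := by simp; ring
    _ ≤ m * C := by
        gcongr
        exact_mod_cast i.2

lemma span_real_span_int (s : Set E) :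
    Submodule.span ℝ ((Submodule.span ℤ s : Submodule ℤ E) : Set E) = Submodule.span ℝ s :=
  Submodule.span_span_of_tower ℤ ℝ s

lemma span_real_eq_of_span_int_eq {s t : Set E}
    (h : Submodule.span ℤ s = Submodule.span ℤ t) : Submodule.span ℝ s = Submodule.span ℝ t := by
  rw [← span_real_span_int s, h, span_real_span_int]

lemma mem_span_real_of_mem_span_int {s : Set E} {v : E}
    (h : v ∈ Submodule.span ℤ s) : v ∈ Submodule.span ℝ s := by
  rw [← span_real_span_int s]
  exact Submodule.subset_span h

/-- A vector can be size-reduced against the Gram-Schmidt vectors of smaller index. -/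
lemma exists_sub_sizeReduced {b : Fin m → E} (hb : LinearIndependent ℝ b) (i : Fin m) (d : ℕ) :
    ∃ c ∈ Submodule.span ℤ (b '' Set.Iio i), ∀ j < i, (i : ℕ) ≤ j + d →
      |inner ℝ (b i - c) (gramSchmidt ℝ b j) / ‖gramSchmidt ℝ b j‖ ^ 2| ≤ 1 / 2 := by
  induction d with
  | zero => exact ⟨0, zero_mem _, fun j hj h => absurd hj (by simpa using h)⟩
  | succ d ih =>
    obtain ⟨c, hc, h⟩ := ih
    by_cases hd : (i : ℕ) < d + 1
    · exact ⟨c, hc, fun j hj _ => h j hj (by omega)⟩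
    have hki : (i : ℕ) - (d + 1) < m := by omega
    set k : Fin m := ⟨(i : ℕ) - (d + 1), hki⟩ with hk
    have hk' : k < i := by rw [Fin.lt_def, hk]; simp only; omega
    have hn : ‖gramSchmidt ℝ b k‖ ^ 2 ≠ 0 := by
      have := gramSchmidt_ne_zero k hb
      positivity
    set q : ℝ := inner ℝ (b i - c) (gramSchmidt ℝ b k) / ‖gramSchmidt ℝ b k‖ ^ 2 with hq
    -- Rounding settles the coefficient at `k`. Those at `j > k` are unaffected because `b k` is
    -- orthogonal to the later Gram-Schmidt vectors; this is why indices are treated downwards from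
    -- `i - 1`.
    refine ⟨c + round q • b k, Submodule.add_mem _ hc
      (Submodule.smul_mem _ _ (Submodule.subset_span ⟨k, hk', rfl⟩)), fun j hj hjd => ?_⟩
    have hz : (round q • b k : E) = (round q : ℝ) • b k := (Int.cast_smul_eq_zsmul ℝ _ _).symm
    rw [← sub_sub, inner_sub_left, hz, inner_smul_left]
    rcases eq_or_ne j k with rfl | hne
    · rw [inner_self_gramSchmidt, sub_div]
      simp only [conj_trivial]
      rw [mul_div_cancel_right₀ _ hn]
      exact abs_sub_round _
    · have hkj : k < j := by
        rw [Fin.lt_def, hk]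
        have : (j : ℕ) ≠ k := fun h => hne (Fin.ext h)
        rw [hk] at this
        simp only at this ⊢
        omega
      rw [real_inner_comm _ (b k), gramSchmidt_inv_triangular ℝ b hkj, mul_zero, sub_zero]
      refine h j hj ?_
      rw [Fin.lt_def, hk] at hkj
      simp only at hkj
      omega

/-- The change of family is unitriangular over `ℤ`, so it preserves the span of every initial
segment. -/
lemma span_int_image_Iio_eq {F : Type*} [AddCommGroup F] {b c : Fin m → F}
    (h : ∀ i, c i - b i ∈ Submodule.span ℤ (b '' Set.Iio i)) (k : ℕ) :
    Submodule.span ℤ (c '' {j | (j : ℕ) < k}) = Submodule.span ℤ (b '' {j | (j : ℕ) < k}) := by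
  induction k with
  | zero => simp
  | succ k ih =>
    apply le_antisymm
    · rw [Submodule.span_le]
      rintro _ ⟨j, hj, rfl⟩
      rw [← sub_add_cancel (c j) (b j)]
      refine Submodule.add_mem _ (Submodule.span_mono (Set.image_mono ?_) (h j))
        (Submodule.subset_span ⟨j, hj, rfl⟩)
      intro i hi
      simp only [Set.mem_Iio, Set.mem_ofPred_eq, Fin.lt_def] at hi hj ⊢
      omega
    · have hle : Submodule.span ℤ (c '' {j | (j : ℕ) < k})
          ≤ Submodule.span ℤ (c '' {j | (j : ℕ) < k + 1}) :=
        Submodule.span_mono (Set.image_mono fun i hi => Nat.lt_succ_of_lt hi)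
      rw [Submodule.span_le]
      rintro _ ⟨j, hj, rfl⟩
      rw [← sub_sub_cancel (c j) (b j)]
      refine Submodule.sub_mem _ (Submodule.subset_span ⟨j, hj, rfl⟩) (hle ?_)
      rw [ih]
      refine Submodule.span_mono (Set.image_mono ?_) (h j)
      intro i hi
      simp only [Set.mem_Iio, Set.mem_ofPred_eq, Fin.lt_def] at hi hj ⊢
      omega

lemma linearIndependent_of_span_int_eq {b c : Fin m → E} (hb : LinearIndependent ℝ b)
    (h : Submodule.span ℤ (Set.range c) = Submodule.span ℤ (Set.range b)) :
    LinearIndependent ℝ c := by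
  have h' := span_real_eq_of_span_int_eq h
  rw [linearIndependent_iff_card_eq_finrank_span] at hb ⊢
  rw [hb, Set.finrank, Set.finrank, h']

/-- Size reduction. -/
lemma exists_sizeReduced {b : Fin m → E} (hb : LinearIndependent ℝ b) :
    ∃ c : Fin m → E, Submodule.span ℤ (Set.range c) = Submodule.span ℤ (Set.range b) ∧
      gramSchmidt ℝ c = gramSchmidt ℝ b ∧ ∀ i j : Fin m, j < i → |gsCoeff c i j| ≤ 1 / 2 := by
  -- With `d = i` the restriction `i ≤ j + d` is vacuous, so all `j < i` are covered.
  choose c hc h using fun i => exists_sub_sizeReduced hb i i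
  have hsub : ∀ i, (b i - c i) - b i ∈ Submodule.span ℤ (b '' Set.Iio i) := fun i => by
    rw [sub_sub_cancel_left]
    exact Submodule.neg_mem _ (hc i)
  have hspan := span_int_image_Iio_eq (c := fun i => b i - c i) hsub
  have hgs : gramSchmidt ℝ (fun i => b i - c i) = gramSchmidt ℝ b := by
    funext j
    exact gramSchmidt_congr (span_real_eq_of_span_int_eq (hspan j))
      (mem_span_real_of_mem_span_int (hsub j))
  refine ⟨fun i => b i - c i, ?_, hgs, fun i j hj => ?_⟩
  · have hu : {j : Fin m | (j : ℕ) < m} = Set.univ := Set.eq_univ_of_forall fun j => j.2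
    simpa only [hu, Set.image_univ] using hspan m
  · rw [gsCoeff, hgs]
    exact h i j hj (by omega)

end GramSchmidt

end IntegerRelation

namespace IntegerRelation

open InnerProductSpace

/-! ### LLL-reduced bases: existence and bounds -/

section LLL

variable {E : Type*} [NormedAddCommGroup E] [InnerProductSpace ℝ E] {m : ℕ}

lemma swap_image_Iio {i j k : Fin m} (hij : (j : ℕ) + 1 = i) (hk : k ≠ i) :
    Equiv.swap i j '' Set.Iio k = Set.Iio k := by
  have hk' : (k : ℕ) ≠ i := fun h => hk (Fin.ext h)
  rw [Equiv.image_eq_preimage_symm, Equiv.symm_swap]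
  ext l
  simp only [Set.mem_preimage, Set.mem_Iio, Equiv.swap_apply_def, Fin.lt_def]
  split_ifs with h1 h2
  · subst h1; omega
  · subst h2; omega
  · rfl

lemma comp_swap_image_Iio {F : Type*} (c : Fin m → F) {i j k : Fin m} (hij : (j : ℕ) + 1 = i) (hk : k ≠ i) :
    (c ∘ Equiv.swap i j) '' Set.Iio k = c '' Set.Iio k := by
  rw [Set.image_comp, swap_image_Iio hij hk]

lemma gramSchmidt_comp_swap_of_ne (c : Fin m → E) {i j k : Fin m} (hij : (j : ℕ) + 1 = i)
    (hi : k ≠ i) (hj : k ≠ j) :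
    gramSchmidt ℝ (c ∘ Equiv.swap i j) k = gramSchmidt ℝ c k := by
  refine gramSchmidt_congr (by rw [comp_swap_image_Iio c hij hi]) ?_
  simp [Equiv.swap_apply_of_ne_of_ne hi hj]

/-- The right-hand vector is `c i` minus its components along the Gram-Schmidt vectors before `j`,
hence in the coset of `c i` modulo the predecessors of `j`. -/
lemma norm_gramSchmidt_comp_swap_left_le (c : Fin m → E) {i j : Fin m} (hij : (j : ℕ) + 1 = i) :
    ‖gramSchmidt ℝ (c ∘ Equiv.swap i j) j‖
      ≤ ‖gramSchmidt ℝ c i + gsCoeff c i j • gramSchmidt ℝ c j‖ := by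
  have hne : j ≠ i := by rintro rfl; omega
  have hIio : Finset.Iio i = insert j (Finset.Iio j) := by
    ext l
    simp only [Finset.mem_Iio, Finset.mem_insert, Fin.lt_def, Fin.ext_iff]
    omega
  apply norm_gramSchmidt_le_of_sub_mem
  rw [comp_swap_image_Iio c hij hne, Function.comp_apply, Equiv.swap_apply_right,
    self_eq_gramSchmidt_add_sum c i, hIio, Finset.sum_insert (by simp), ← add_assoc,
    add_sub_cancel_left, ← span_gramSchmidt_Iio ℝ c j]
  refine Submodule.sum_mem _ fun l hl => Submodule.smul_mem _ _ (Submodule.subset_span ?_)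
  exact ⟨l, by simpa using hl, rfl⟩

lemma norm_gramSchmidt_comp_swap_right_le (c : Fin m → E) {i j : Fin m} (hij : (j : ℕ) + 1 = i) :
    ‖gramSchmidt ℝ (c ∘ Equiv.swap i j) i‖ ≤ ‖gramSchmidt ℝ c j‖ := by
  have hne : j ≠ i := by rintro rfl; omega
  apply norm_gramSchmidt_le_of_sub_mem
  rw [Function.comp_apply, Equiv.swap_apply_left]
  have h := self_sub_gramSchmidt_mem_span c j
  rw [← comp_swap_image_Iio c hij hne] at h
  refine Submodule.span_mono (Set.image_mono (Set.Iio_subset_Iio ?_)) h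
  rw [Fin.le_def]
  omega

/-- A lattice with finitely many vectors in every ball has an LLL-reduced basis. -/
theorem exists_isLLLReduced {b : Fin m → E} (hb : LinearIndependent ℝ b)
    (hfin : ∀ K : ℝ, {v | v ∈ Submodule.span ℤ (Set.range b) ∧ ‖v‖ ≤ K}.Finite) :
    ∃ c : Fin m → E,
      Submodule.span ℤ (Set.range c) = Submodule.span ℤ (Set.range b) ∧ IsLLLReduced c := by
  obtain ⟨C, hC⟩ : ∃ C, ∀ j, ‖gramSchmidt ℝ b j‖ ≤ C := by
    obtain ⟨C, hC⟩ := (Set.finite_range fun j => ‖gramSchmidt ℝ b j‖).bddAbove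
    exact ⟨C, fun j => hC ⟨j, rfl⟩⟩
  -- Bounded Gram-Schmidt norms and size reduction bound the basis vectors themselves, so `F` is
  -- finite.
  set F : Set (Fin m → E) := {c | Submodule.span ℤ (Set.range c) = Submodule.span ℤ (Set.range b) ∧
    (∀ i j : Fin m, j < i → |gsCoeff c i j| ≤ 1 / 2) ∧ ∀ j, ‖gramSchmidt ℝ c j‖ ≤ C} with hF
  have hFfin : F.Finite := by
    refine (Set.Finite.pi' fun _ => hfin (m * C)).subset fun c hc i => ⟨?_, ?_⟩
    · rw [← hc.1]
      exact Submodule.subset_span ⟨i, rfl⟩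
    · exact norm_le_of_sizeReduced (hc.2.1 i) fun j _ => hc.2.2 j
  have hFne : F.Nonempty := by
    obtain ⟨c, hspan, hgs, hc⟩ := exists_sizeReduced hb
    exact ⟨c, hspan, hc, fun j => by rw [hgs]; exact hC j⟩
  -- Take the lexicographically smallest profile of Gram-Schmidt norms. If the Lovász condition
  -- failed at `j`, `i`, swapping and size-reducing would shorten entry `j` and keep all earlier
  -- ones.
  obtain ⟨c, ⟨hspan, hsize, hcC⟩, hmin⟩ :=
    Set.exists_min_image F (fun c => toLex fun j => ‖gramSchmidt ℝ c j‖) hFfin hFne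
  have hc := linearIndependent_of_span_int_eq hb hspan
  refine ⟨c, hspan, hc, hsize, fun i j hij => ?_⟩
  by_contra! hlt
  obtain ⟨d, hdspan, hdgs, hdsize⟩ := exists_sizeReduced
    (b := c ∘ Equiv.swap i j) (hc.comp _ (Equiv.injective _))
  rw [EquivLike.range_comp c] at hdspan
  have hlt' : ‖gramSchmidt ℝ d j‖ < ‖gramSchmidt ℝ c j‖ := by
    rw [hdgs]
    refine (norm_gramSchmidt_comp_swap_left_le c hij).trans_lt ?_
    refine lt_of_pow_lt_pow_left₀ 2 (norm_nonneg _) (hlt.trans_le ?_)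
    nlinarith [sq_nonneg ‖gramSchmidt ℝ c j‖]
  have hdF : d ∈ F := by
    refine ⟨hdspan.trans hspan, hdsize, fun k => ?_⟩
    by_cases hkj : k = j
    · rw [hkj]
      exact hlt'.le.trans (hcC j)
    rw [hdgs]
    by_cases hki : k = i
    · rw [hki]
      exact (norm_gramSchmidt_comp_swap_right_le c hij).trans (hcC j)
    · rw [gramSchmidt_comp_swap_of_ne c hij hki hkj]
      exact hcC k
  refine (hmin d hdF).not_gt ⟨j, fun k hk => ?_, hlt'⟩
  change k < j at hk
  have hki : k ≠ i := by
    rw [Fin.lt_def] at hk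
    rintro rfl
    omega
  change ‖gramSchmidt ℝ d k‖ = ‖gramSchmidt ℝ c k‖
  rw [hdgs, gramSchmidt_comp_swap_of_ne c hij hki hk.ne]

/-- Orthogonality turns the Lovász condition into `(3/4 - μ²) ‖b̄ⱼ‖² ≤ ‖b̄ᵢ‖²` with `μ² ≤ 1/4`. This
gives the factor `√2`; the cruder `2` suffices. -/
lemma IsLLLReduced.norm_gramSchmidt_le {b : Fin m → E} (hb : IsLLLReduced b) {i j : Fin m}
    (hij : (j : ℕ) + 1 = i) : ‖gramSchmidt ℝ b j‖ ≤ 2 * ‖gramSchmidt ℝ b i‖ := by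
  have hlt : j < i := by rw [Fin.lt_def]; omega
  have h := hb.lovasz i j hij
  have hμ := sq_le_sq' (abs_le.1 (hb.sizeReduced i j hlt)).1 (abs_le.1 (hb.sizeReduced i j hlt)).2
  have h0 : inner ℝ (gramSchmidt ℝ b i) (gsCoeff b i j • gramSchmidt ℝ b j) = (0 : ℝ) := by
    rw [inner_smul_right, gramSchmidt_orthogonal ℝ b hlt.ne', mul_zero]
  rw [norm_add_sq_real, h0, norm_smul, mul_pow, Real.norm_eq_abs, sq_abs] at h
  refine le_of_sq_le_sq ?_ (by positivity)
  nlinarith [sq_nonneg ‖gramSchmidt ℝ b j‖, sq_nonneg ‖gramSchmidt ℝ b i‖]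

lemma IsLLLReduced.norm_gramSchmidt_le_two_pow {b : Fin m → E} (hb : IsLLLReduced b) {l : Fin m}
    {C : ℝ} (hl : ‖gramSchmidt ℝ b l‖ ≤ C) (d : ℕ) :
    ∀ j : Fin m, (j : ℕ) + d = l → ‖gramSchmidt ℝ b j‖ ≤ 2 ^ d * C := by
  induction d with
  | zero =>
    intro j hj
    obtain rfl : j = l := Fin.ext hj
    simpa using hl
  | succ d ih =>
    intro j hj
    have h := ih ⟨j + 1, by omega⟩ (by simp only; omega)
    have h' := hb.norm_gramSchmidt_le (i := ⟨j + 1, by omega⟩) (j := j) rfl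
    rw [pow_succ]
    linarith

/-- If the Gram-Schmidt vector of index `l` of an LLL-reduced basis is short, then so are
the basis vectors of index at most `l`. -/
lemma IsLLLReduced.norm_le {b : Fin m → E} (hb : IsLLLReduced b) {l : Fin m}
    {C : ℝ} (hl : ‖gramSchmidt ℝ b l‖ ≤ C) {i : Fin m} (hi : i ≤ l) :
    ‖b i‖ ≤ m * (2 ^ m * C) := by
  refine norm_le_of_sizeReduced (hb.sizeReduced i) fun j hj => ?_
  have hC : 0 ≤ C := (norm_nonneg _).trans hl
  have hjl := Fin.le_def.1 (hj.trans hi)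
  refine (hb.norm_gramSchmidt_le_two_pow hl (l - j) j (by omega)).trans ?_
  gcongr
  · norm_num
  · omega

lemma removeLong_le (b : Fin m → E) (bound : ℝ) (r : ℕ) : removeLong b bound r ≤ r := by
  induction r with
  | zero => simp [removeLong]
  | succ r ih =>
    rw [removeLong]
    split_ifs
    · exact ih.trans r.le_succ
    · exact le_rfl

lemma lt_norm_of_removeLong_le (b : Fin m → E) (bound : ℝ) (r : ℕ) (i : Fin m)
    (hi : removeLong b bound r ≤ i) (hir : (i : ℕ) < r) : bound < ‖gramSchmidt ℝ b i‖ := by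
  induction r with
  | zero => omega
  | succ r ih =>
    rw [removeLong] at hi
    split_ifs at hi with h
    · rcases Nat.lt_succ_iff_lt_or_eq.1 hir with h' | h'
      · exact ih hi h'
      · obtain ⟨_, h⟩ := h
        convert h
    · omega

lemma norm_le_of_removeLong_eq (b : Fin m → E) (bound : ℝ) (r : ℕ) {k : Fin m}
    (hk : removeLong b bound r = k + 1) : ‖gramSchmidt ℝ b k‖ ≤ bound := by
  induction r with
  | zero => simp [removeLong] at hk
  | succ r ih =>
    rw [removeLong] at hk
    split_ifs at hk with h
    · exact ih hk
    · obtain rfl : r = k := by omega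
      by_contra! h'
      exact h ⟨k.2, h'⟩

/-- The coefficients of a short lattice vector vanish where the Gram-Schmidt vectors are long. -/
lemma coeff_eq_zero_of_norm_le {b : Fin m → E} {r : ℕ} {bound : ℝ}
    (hlong : ∀ i : Fin m, r ≤ i → bound < ‖gramSchmidt ℝ b i‖) {a : Fin m → ℤ}
    (ha : ‖∑ i, a i • b i‖ ≤ bound) (i : Fin m) (hi : r ≤ i) : a i = 0 := by
  by_contra h
  have hne : (Finset.univ.filter fun i : Fin m => a i ≠ 0).Nonempty := ⟨i, by simpa using h⟩
  -- At the largest index `k` with nonzero coefficient, the inner product with the Gram-Schmidt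
  -- vector sees only `a k`; as `|a k| ≥ 1`, Cauchy-Schwarz makes the sum at least as long as that
  -- vector.
  obtain ⟨k, hk, hmax⟩ := Finset.exists_max_image _ id hne
  simp only [Finset.mem_filter, Finset.mem_univ, true_and, id_eq] at hk hmax
  have hrk : r ≤ k := hi.trans (Fin.le_def.1 (hmax i h))
  have hinner : inner ℝ (gramSchmidt ℝ b k) (∑ i, a i • b i) = a k * ‖gramSchmidt ℝ b k‖ ^ 2 := by
    rw [inner_sum, Finset.sum_eq_single k]
    · rw [← Int.cast_smul_eq_zsmul ℝ, inner_smul_right, real_inner_comm, inner_self_gramSchmidt]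
    · intro l _ hl
      rw [← Int.cast_smul_eq_zsmul ℝ, inner_smul_right]
      rcases lt_or_gt_of_ne hl with hl | hl
      · rw [gramSchmidt_inv_triangular ℝ b hl, mul_zero]
      · have : a l = 0 := by
          by_contra h0
          exact (hmax l h0).not_gt hl
        simp [this]
    · simp
  have hcs := abs_real_inner_le_norm (gramSchmidt ℝ b k) (∑ i, a i • b i)
  rw [hinner, abs_mul, abs_of_nonneg (sq_nonneg ‖gramSchmidt ℝ b k‖)] at hcs
  have h1 : (1 : ℝ) ≤ |(a k : ℝ)| := by exact_mod_cast Int.one_le_abs hk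
  have hb := hlong k hrk
  have hpos : 0 < ‖gramSchmidt ℝ b k‖ := (norm_nonneg _).trans_lt (ha.trans_lt hb)
  nlinarith [mul_pos hpos hpos]

end LLL

end IntegerRelation

namespace IntegerRelation

open InnerProductSpace

/-! ### The algorithm: loop invariant and termination -/

section Algorithm

variable {n : ℕ}

/-- `vecToEuclidean` as a linear map. -/
def vecToEuclideanHom (n : ℕ) : Vec n →ₗ[ℤ] EuclideanSpace ℝ (Fin n ⊕ Fin 2) where
  toFun := vecToEuclidean
  map_add' u v := by
    ext (i | i)
    · simp [vecToEuclidean]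
    · fin_cases i <;> simp [vecToEuclidean]
  map_smul' a v := by
    ext (i | i)
    · simp [vecToEuclidean]
    · fin_cases i <;> simp [vecToEuclidean]

/-- `replaceVec` as a linear map. -/
def replaceHom (w : ℕ) (re im : Fin n → ℚ) : Vec n →ₗ[ℤ] Vec n where
  toFun := replaceVec w re im
  map_add' u v := by
    simp [replaceVec, add_mul, Finset.sum_add_distrib, mul_add]
  map_smul' a v := by
    simp [replaceVec, mul_assoc, ← Finset.mul_sum, mul_left_comm]

@[simp]
lemma vecToEuclideanHom_apply (v : Vec n) : vecToEuclideanHom n v = vecToEuclidean v := rfl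

lemma vecToEuclidean_injective : Function.Injective (vecToEuclidean (n := n)) := by
  rintro ⟨e, s, t⟩ ⟨e', s', t'⟩ h
  have h' := fun i => congrArg (fun v : EuclideanSpace ℝ (Fin n ⊕ Fin 2) => v i) h
  have he : e = e' := by
    funext i
    simpa [vecToEuclidean] using h' (Sum.inl i)
  have hs : s = s' := by simpa [vecToEuclidean] using h' (Sum.inr 0)
  have ht : t = t' := by simpa [vecToEuclidean] using h' (Sum.inr 1)
  rw [he, hs, ht]

lemma norm_vecToEuclidean_sq (v : Vec n) :
    ‖vecToEuclidean v‖ ^ 2 = ∑ i, (v.1 i : ℝ) ^ 2 + ((v.2.1 : ℝ) ^ 2 + (v.2.2 : ℝ) ^ 2) := by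
  simp [EuclideanSpace.norm_sq_eq, vecToEuclidean, Fin.sum_univ_two]

lemma abs_apply_le_norm (v : Vec n) (i : Fin n) : |(v.1 i : ℝ)| ≤ ‖vecToEuclidean v‖ := by
  simpa [vecToEuclidean] using PiLp.norm_apply_le (vecToEuclidean v) (Sum.inl i)

lemma abs_re_le_norm (v : Vec n) : |(v.2.1 : ℝ)| ≤ ‖vecToEuclidean v‖ :=
  PiLp.norm_apply_le (vecToEuclidean v) (Sum.inr 0)

lemma abs_im_le_norm (v : Vec n) : |(v.2.2 : ℝ)| ≤ ‖vecToEuclidean v‖ :=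
  PiLp.norm_apply_le (vecToEuclidean v) (Sum.inr 1)

lemma finite_abs_le (n : ℕ) (K : ℝ) : {e : Fin n → ℤ | ∀ i, |(e i : ℝ)| ≤ K}.Finite := by
  have hfin : {z : ℤ | |(z : ℝ)| ≤ K}.Finite := by
    refine (Set.finite_Icc (-⌊K⌋) ⌊K⌋).subset fun z hz => ?_
    have h : |z| ≤ ⌊K⌋ := Int.le_floor.2 (by exact_mod_cast hz)
    exact abs_le.1 h
  exact Set.Finite.pi' fun _ => hfin

/-- `replaceVec` is linear and idempotent, since it reads only the integer part; its fixed points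
form a submodule containing the generators. -/
lemma replaceVec_eq_self_of_mem {w : ℕ} {re im : Fin n → ℚ} {B : Set (Vec n)} {v : Vec n}
    (hv : v ∈ Submodule.span ℤ (replaceVec w re im '' B)) : replaceVec w re im v = v := by
  have h : Submodule.span ℤ (replaceVec w re im '' B)
      ≤ LinearMap.eqLocus (replaceHom w re im) LinearMap.id := by
    rw [Submodule.span_le]
    rintro _ ⟨u, _, rfl⟩
    rfl
  exact h hv

lemma map_fst_span_replaceVec (w : ℕ) (re im : Fin n → ℚ) (B : Set (Vec n)) :
    (Submodule.span ℤ (replaceVec w re im '' B)).map (LinearMap.fst ℤ (Fin n → ℤ) (ℚ × ℚ))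
      = Submodule.span ℤ (Prod.fst '' B) := by
  rw [Submodule.map_span, LinearMap.coe_fst, Set.image_image]
  rfl

lemma linearIndependent_vecToEuclidean {r : ℕ} {c : Fin r → Vec n}
    (hc : LinearIndependent ℝ fun i (j : Fin n) => ((c i).1 j : ℝ)) :
    LinearIndependent ℝ fun i => vecToEuclidean (c i) := by
  let f : EuclideanSpace ℝ (Fin n ⊕ Fin 2) →ₗ[ℝ] Fin n → ℝ :=
    { toFun := fun v j => v (Sum.inl j)
      map_add' := fun _ _ => rfl
      map_smul' := fun _ _ => rfl }
  exact LinearIndependent.of_comp f hc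

/-- Fixed vectors lie on the graph of a real-linear map, so they are a linear image of their integer
parts. -/
lemma linearIndependent_fst {w : ℕ} {re im : Fin n → ℚ} {r : ℕ} {c : Fin r → Vec n}
    (hR : ∀ i, replaceVec w re im (c i) = c i)
    (hc : LinearIndependent ℝ fun i => vecToEuclidean (c i)) :
    LinearIndependent ℝ fun i (j : Fin n) => ((c i).1 j : ℝ) := by
  let g : (Fin n → ℝ) →ₗ[ℝ] EuclideanSpace ℝ (Fin n ⊕ Fin 2) :=
    { toFun := fun e => WithLp.toLp 2
        (Sum.elim e ![(w : ℝ) * ∑ i, e i * re i, (w : ℝ) * ∑ i, e i * im i])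
      map_add' := fun a b => by
        ext (i | i)
        · simp
        · fin_cases i <;> simp [add_mul, Finset.sum_add_distrib, mul_add]
      map_smul' := fun a b => by
        ext (i | i)
        · simp
        · fin_cases i <;> simp [mul_assoc, ← Finset.mul_sum, mul_left_comm] }
  refine LinearIndependent.of_comp g ?_
  convert hc using 1
  funext i
  rw [← hR i]
  simp [g, vecToEuclidean, replaceVec]

lemma exists_isApprox (x : Fin n → ℂ) {w : ℕ} (hw : 0 < w) : ∃ re im, IsApprox x w re im := by
  have h : ∀ a : ℝ, ∀ i : Fin n, ∃ q : ℚ, |(q : ℝ) - a| < 1 / ((n : ℝ) * w) := fun a i => by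
    have hn : 0 < n := i.pos
    have hpos : 0 < 1 / ((n : ℝ) * w) := by positivity
    obtain ⟨q, h1, h2⟩ := exists_rat_btwn (show a - 1 / ((n : ℝ) * w) < a + 1 / ((n : ℝ) * w) by
      linarith)
    exact ⟨q, abs_lt.2 ⟨by linarith, by linarith⟩⟩
  choose re hre using fun i => h (x i).re i
  choose im him using fun i => h (x i).im i
  exact ⟨re, im, fun i => ⟨hre i, him i⟩⟩

/-- Replacing real numbers by approximations changes a linear form by little. -/
lemma abs_mul_sum_sub_le {w : ℕ} (hw : 0 < w) {q : Fin n → ℚ} {a : Fin n → ℝ}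
    (hq : ∀ i, |(q i : ℝ) - a i| < 1 / ((n : ℝ) * w)) {e : Fin n → ℤ} {K : ℝ} (hK : 0 ≤ K)
    (he : ∀ i, |(e i : ℝ)| ≤ K) :
    |(w : ℝ) * ∑ i, (e i : ℝ) * q i - (w : ℝ) * ∑ i, (e i : ℝ) * a i| ≤ K := by
  have hw' : (0 : ℝ) < w := by exact_mod_cast hw
  rw [← mul_sub, ← Finset.sum_sub_distrib, abs_mul, abs_of_pos hw']
  calc (w : ℝ) * |∑ i, ((e i : ℝ) * q i - (e i : ℝ) * a i)|
      ≤ (w : ℝ) * ∑ _i : Fin n, K * (1 / ((n : ℝ) * w)) := by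
        gcongr
        refine (Finset.abs_sum_le_sum_abs _ _).trans (Finset.sum_le_sum fun i _ => ?_)
        rw [← mul_sub, abs_mul]
        exact mul_le_mul (he i) (hq i).le (abs_nonneg _) hK
    _ ≤ K := by
        -- For `n = 0` the tolerance is `1 / 0 = 0`, but the sum is empty.
        rcases Nat.eq_zero_or_pos n with rfl | hn
        · simpa using hK
        · have : (n : ℝ) ≠ 0 := by positivity
          simp only [Finset.sum_const, Finset.card_univ, Fintype.card_fin, nsmul_eq_mul]
          field_simp
          exact le_rfl

lemma re_sum (x : Fin n → ℂ) (e : Fin n → ℤ) :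
    (∑ i, (e i : ℂ) * x i).re = ∑ i, (e i : ℝ) * (x i).re := by
  simp [Complex.re_sum]

lemma im_sum (x : Fin n → ℂ) (e : Fin n → ℤ) :
    (∑ i, (e i : ℂ) * x i).im = ∑ i, (e i : ℝ) * (x i).im := by
  simp [Complex.im_sum]

lemma mem_relationLattice {x : Fin n → ℂ} {e : Fin n → ℤ} :
    e ∈ relationLattice x ↔ ∑ i, (e i : ℂ) * x i = 0 := Iff.rfl

/-- A relation of height at most `M` yields a short vector. -/
lemma norm_le_of_mem_relationLattice {x : Fin n → ℂ} {w : ℕ} (hw : 0 < w) {re im : Fin n → ℚ}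
    (hx : IsApprox x w re im) {M : ℝ} {v : Vec n} (hv : replaceVec w re im v = v)
    (hL : v.1 ∈ relationLattice x) (hM : ‖v.1‖ ≤ M) :
    ‖vecToEuclidean v‖ ≤ Real.sqrt ((n : ℝ) + 2) * M := by
  have hM0 : 0 ≤ M := (norm_nonneg _).trans hM
  have he : ∀ i, |(v.1 i : ℝ)| ≤ M := fun i => by
    rw [← Int.norm_eq_abs]
    exact (norm_le_pi_norm v.1 i).trans hM
  have hre := abs_mul_sum_sub_le hw (fun i => (hx i).1) hM0 he
  have him := abs_mul_sum_sub_le hw (fun i => (hx i).2) hM0 he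
  rw [← re_sum, mem_relationLattice.1 hL, Complex.zero_re, mul_zero, sub_zero] at hre
  rw [← im_sum, mem_relationLattice.1 hL, Complex.zero_im, mul_zero, sub_zero] at him
  have h1 : (v.2.1 : ℝ) = w * ∑ i, (v.1 i : ℝ) * re i := by
    nth_rw 1 [← hv]
    simp [replaceVec]
  have h2 : (v.2.2 : ℝ) = w * ∑ i, (v.1 i : ℝ) * im i := by
    nth_rw 1 [← hv]
    simp [replaceVec]
  rw [← h1] at hre
  rw [← h2] at him
  -- Each of the `n + 2` coordinates is at most `M` in absolute value.
  refine le_of_sq_le_sq ?_ (by positivity)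
  rw [norm_vecToEuclidean_sq, mul_pow, Real.sq_sqrt (by positivity)]
  have hs : ∀ a : ℝ, |a| ≤ M → a ^ 2 ≤ M ^ 2 := fun a ha => sq_le_sq' (abs_le.1 ha).1 (abs_le.1 ha).2
  have hsum : ∑ i, (v.1 i : ℝ) ^ 2 ≤ ∑ _i : Fin n, M ^ 2 :=
    Finset.sum_le_sum fun i _ => hs _ (he i)
  simp only [Finset.sum_const, Finset.card_univ, Fintype.card_fin, nsmul_eq_mul] at hsum
  linarith [hs _ hre, hs _ him]

/-- A short vector yields an approximate relation. -/
lemma norm_sum_le_of_norm_le {x : Fin n → ℂ} {w : ℕ} (hw : 0 < w) {re im : Fin n → ℚ}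
    (hx : IsApprox x w re im) {K : ℝ} {v : Vec n} (hv : replaceVec w re im v = v)
    (hK : ‖vecToEuclidean v‖ ≤ K) : ‖∑ i, (v.1 i : ℂ) * x i‖ * w ≤ 4 * K := by
  have hK0 : 0 ≤ K := (norm_nonneg _).trans hK
  have he : ∀ i, |(v.1 i : ℝ)| ≤ K := fun i => (abs_apply_le_norm v i).trans hK
  have hre := abs_mul_sum_sub_le hw (fun i => (hx i).1) hK0 he
  have him := abs_mul_sum_sub_le hw (fun i => (hx i).2) hK0 he
  have h1 : (v.2.1 : ℝ) = w * ∑ i, (v.1 i : ℝ) * re i := by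
    nth_rw 1 [← hv]
    simp [replaceVec]
  have h2 : (v.2.2 : ℝ) = w * ∑ i, (v.1 i : ℝ) * im i := by
    nth_rw 1 [← hv]
    simp [replaceVec]
  rw [← h1, ← re_sum] at hre
  rw [← h2, ← im_sum] at him
  have h3 := (abs_re_le_norm v).trans hK
  have h4 := (abs_im_le_norm v).trans hK
  have hw' : (0 : ℝ) ≤ w := by positivity
  have hnorm := Complex.norm_le_abs_re_add_abs_im (∑ i, (v.1 i : ℂ) * x i)
  generalize ∑ i, (v.1 i : ℂ) * x i = z at *
  -- One `K` bounds the coordinate of `v`, the other the approximation error.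
  have h5 : |(w : ℝ) * z.re| ≤ 2 * K := by
    rw [abs_le] at *
    constructor <;> linarith
  have h6 : |(w : ℝ) * z.im| ≤ 2 * K := by
    rw [abs_le] at *
    constructor <;> linarith
  rw [abs_mul, abs_of_nonneg hw'] at h5 h6
  nlinarith

/-- The invariant of the main loop. -/
structure Invariant (x : Fin n → ℂ) (s : State n) : Prop where
  w_pos : 0 < s.w
  exists_family : ∃ (r : ℕ) (c : Fin r → Vec n), s.B = Set.range c ∧
    LinearIndependent ℝ fun i (j : Fin n) => ((c i).1 j : ℝ)
  relationLattice_le : relationLattice x ≤ Submodule.span ℤ (Prod.fst '' s.B)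

lemma Invariant.init (x : Fin n → ℂ) : Invariant x (State.init n) where
  w_pos := one_pos
  exists_family := by
    refine ⟨n, fun i => (Pi.single i 1, 0, 0), rfl, ?_⟩
    convert Pi.linearIndependent_single_one (Fin n) ℝ using 1
    funext i j
    simp [Pi.single_apply]
  relationLattice_le := by
    have h : Prod.fst '' (State.init n).B = Set.range (Pi.basisFun ℤ (Fin n)) := by
      simp only [State.init, ← Set.range_comp]
      congr 1
      funext i
      simp
    rw [h, (Pi.basisFun ℤ (Fin n)).span_eq]
    exact le_top

lemma span_vecToEuclidean {m : ℕ} (b : Fin m → Vec n) :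
    Submodule.span ℤ (Set.range fun i => vecToEuclidean (b i))
      = (Submodule.span ℤ (Set.range b)).map (vecToEuclideanHom n) := by
  rw [Submodule.map_span, ← Set.range_comp]
  rfl

lemma Invariant.exists_step {x : Fin n → ℂ} {s : State n} (hs : Invariant x s) (M : ℚ)
    (hcond : LoopCond x s) : ∃ s', Step x M s s' := by
  have hw : 0 < 2 * s.w := Nat.mul_pos two_pos hs.w_pos
  obtain ⟨re, im, hx⟩ := exists_isApprox x hw
  obtain ⟨r, c, hB, hc⟩ := hs.exists_family
  have hRB : replaceVec (2 * s.w) re im '' s.B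
      = Set.range fun i => replaceVec (2 * s.w) re im (c i) := by
    rw [hB, ← Set.range_comp]
    rfl
  have hRc : LinearIndependent ℝ fun i => vecToEuclidean (replaceVec (2 * s.w) re im (c i)) :=
    linearIndependent_vecToEuclidean hc
  have hspan := span_vecToEuclidean fun i => replaceVec (2 * s.w) re im (c i)
  rw [← hRB] at hspan
  -- Finiteness in balls: a lattice vector is recovered from its integer part, whose entries are
  -- integers bounded by `K`.
  obtain ⟨b', hb', hred⟩ := exists_isLLLReduced hRc fun K => by
    rw [hspan]
    refine ((finite_abs_le n K).image
      fun e => vecToEuclidean (replaceVec (2 * s.w) re im (e, 0, 0))).subset ?_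
    rintro _ ⟨⟨v, hv, rfl⟩, hK⟩
    refine ⟨v.1, fun i => (abs_apply_le_norm v i).trans hK, ?_⟩
    change vecToEuclidean (replaceVec (2 * s.w) re im v) = _
    rw [replaceVec_eq_self_of_mem hv, vecToEuclideanHom_apply]
  rw [hspan] at hb'
  have hmem : ∀ i, b' i ∈ (Submodule.span ℤ (replaceVec (2 * s.w) re im '' s.B)).map
      (vecToEuclideanHom n) := fun i => hb' ▸ Submodule.subset_span ⟨i, rfl⟩
  choose b _ hbb' using hmem
  obtain rfl : (fun i => vecToEuclidean (b i)) = b' := funext hbb'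
  rw [span_vecToEuclidean] at hb'
  have hspan' := Submodule.map_injective_of_injective
    (f := vecToEuclideanHom n) vecToEuclidean_injective hb'
  exact ⟨⟨2 * s.w, _⟩, hcond, rfl, re, im, hx, r, b, ⟨hspan', hred⟩, rfl⟩

lemma setOf_lt_eq_range {α : Type*} {m r : ℕ} (hr : r ≤ m) (b : Fin m → α) :
    {v | ∃ i : Fin m, (i : ℕ) < r ∧ v = b i} = Set.range (b ∘ Fin.castLE hr) := by
  ext v
  constructor
  · rintro ⟨i, hi, rfl⟩
    exact ⟨⟨i, hi⟩, rfl⟩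
  · rintro ⟨i, rfl⟩
    exact ⟨Fin.castLE hr i, i.2, rfl⟩

/-- It suffices to retain the generators `S` of `L₊`: each lifts to a vector too short to involve a
dropped basis vector. -/
lemma Invariant.step {x : Fin n → ℂ} {M : ℚ} {s s' : State n} (hs : Invariant x s)
    {S : Set (Fin n → ℤ)} (hS : Submodule.span ℤ S = relationLattice x)
    (hM : ∀ b ∈ S, ‖b‖ ≤ (M : ℝ)) (h : Step x M s s') : Invariant x s' := by
  obtain ⟨-, hw, re, im, hx, m, b, ⟨hspan, hred⟩, hB⟩ := h
  have hw' : 0 < s'.w := hw ▸ Nat.mul_pos two_pos hs.w_pos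
  have hR : ∀ i, replaceVec s'.w re im (b i) = b i := fun i =>
    replaceVec_eq_self_of_mem (hspan ▸ Submodule.subset_span (Set.mem_range_self i))
  set bound := Real.sqrt ((n : ℝ) + 2) * M
  set r := removeLong (fun i => vecToEuclidean (b i)) bound m with hr
  refine ⟨hw', ⟨r, _, hB.trans (setOf_lt_eq_range (removeLong_le _ _ _) b), ?_⟩, ?_⟩
  · exact (linearIndependent_fst hR hred.linearIndependent).comp _ (Fin.castLE_injective _)
  · rw [← hS, Submodule.span_le]
    intro e he
    have heL : e ∈ relationLattice x := hS ▸ Submodule.subset_span he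
    have hmem := hs.relationLattice_le heL
    rw [← map_fst_span_replaceVec s'.w re im] at hmem
    obtain ⟨v, hv, rfl⟩ := hmem
    rw [LinearMap.fst_apply] at he heL ⊢
    have hnorm := norm_le_of_mem_relationLattice hw' hx (replaceVec_eq_self_of_mem hv) heL (hM _ he)
    have hvb : v ∈ Submodule.span ℤ (Set.range b) := hspan ▸ hv
    obtain ⟨a, rfl⟩ := (Submodule.mem_span_range_iff_exists_fun ℤ).1 hvb
    rw [← vecToEuclideanHom_apply, map_sum] at hnorm
    simp only [map_smul, vecToEuclideanHom_apply] at hnorm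
    have hzero := coeff_eq_zero_of_norm_le (r := r)
      (fun i hi => lt_norm_of_removeLong_le _ _ m i hi i.2) hnorm
    rw [← LinearMap.fst_apply (R := ℤ), map_sum]
    refine Submodule.sum_mem _ fun i _ => ?_
    by_cases hi : r ≤ i
    · rw [hzero i hi, zero_smul, map_zero]
      exact zero_mem _
    · rw [map_smul]
      refine Submodule.smul_mem _ _ (Submodule.subset_span ⟨b i, ?_, rfl⟩)
      rw [hB]
      exact ⟨i, not_le.1 hi, rfl⟩

lemma Invariant.isLatticeBasis {x : Fin n → ℂ} {s : State n} (hs : Invariant x s)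
    (hcond : ¬ LoopCond x s) : IsLatticeBasis (relationLattice x) s.output := by
  constructor
  · obtain ⟨r, c, hB, hc⟩ := hs.exists_family
    have hind : LinearIndependent ℤ fun i => (c i).1 := by
      let f : (Fin n → ℤ) →ₗ[ℤ] Fin n → ℝ := (Int.castAddHom ℝ).toIntLinearMap.compLeft (Fin n)
      exact LinearIndependent.of_comp f (hc.restrict_scalars' ℤ)
    have hout : s.output = Set.range fun i => (c i).1 := by
      rw [State.output, hB, ← Set.range_comp]
      rfl
    rw [hout]
    exact hind.linearIndepOn_id
  · refine le_antisymm (Submodule.span_le.2 ?_) hs.relationLattice_le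
    rintro _ ⟨v, hv, rfl⟩
    by_contra hvx
    exact hcond ⟨v, hv, hvx⟩

lemma invariant_of_reachable {x : Fin n → ℂ} {M : ℚ} {S : Set (Fin n → ℤ)}
    (hS : Submodule.span ℤ S = relationLattice x) (hM : ∀ b ∈ S, ‖b‖ ≤ (M : ℝ)) {s : State n}
    (h : Reachable x M s) : Invariant x s := by
  induction h with
  | refl => exact Invariant.init x
  | tail _ hstep ih => exact ih.step hS hM hstep

/-- The vectors kept by the loop body are bounded independently of `w`. -/
lemma exists_norm_le_of_step (x : Fin n → ℂ) (M : ℚ) : ∃ K : ℝ, ∀ s s' : State n,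
    0 < s'.w → Step x M s s' → ∀ v ∈ s'.B,
      (∀ i, |(v.1 i : ℝ)| ≤ K) ∧ ‖∑ i, (v.1 i : ℂ) * x i‖ * s'.w ≤ 4 * K := by
  refine ⟨((n + 2 : ℕ) : ℝ) * (2 ^ (n + 2) * (Real.sqrt ((n : ℝ) + 2) * M)), ?_⟩
  rintro s s' hw ⟨-, -, re, im, hx, m, b, ⟨hspan, hred⟩, hB⟩ v hv
  rw [hB] at hv
  obtain ⟨i, hi, rfl⟩ := hv
  -- The dimension of the ambient space bounds `m`, which makes the constant independent of the run.
  have hm : m ≤ n + 2 := by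
    simpa using hred.linearIndependent.fintype_card_le_finrank
  obtain ⟨k, hk⟩ := Nat.exists_eq_succ_of_ne_zero (Nat.ne_zero_of_lt hi)
  have hkm : k < m := by
    have := removeLong_le (fun i => vecToEuclidean (b i)) (Real.sqrt ((n : ℝ) + 2) * M) m
    omega
  have hgs := norm_le_of_removeLong_eq _ _ m (k := ⟨k, hkm⟩) hk
  -- `M` may be negative here; the bound is nonnegative because some Gram-Schmidt vector passed it.
  have h0 := (norm_nonneg _).trans hgs
  have hle := hred.norm_le hgs (i := i) (by rw [Fin.le_def]; simp only; omega)
  have hK := hle.trans (show (m : ℝ) * (2 ^ m * (Real.sqrt ((n : ℝ) + 2) * M))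
      ≤ ((n + 2 : ℕ) : ℝ) * (2 ^ (n + 2) * (Real.sqrt ((n : ℝ) + 2) * M)) by
    gcongr
    norm_num)
  exact ⟨fun j => (abs_apply_le_norm _ j).trans hK, norm_sum_le_of_norm_le hw hx
    (replaceVec_eq_self_of_mem (hspan ▸ Submodule.subset_span (Set.mem_range_self i))) hK⟩

/-- For large `w`, the body of the main loop leaves only relations. -/
lemma eventually_not_loopCond (x : Fin n → ℂ) (M : ℚ) : ∀ᶠ w : ℕ in Filter.atTop,
    ∀ s s' : State n, s'.w = w → Step x M s s' → ¬ LoopCond x s' := by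
  obtain ⟨K, hK⟩ := exists_norm_le_of_step x M
  have hlarge : ∀ᶠ w : ℕ in Filter.atTop, ∀ e ∈ {e : Fin n → ℤ | ∀ i, |(e i : ℝ)| ≤ K},
      ‖∑ i, (e i : ℂ) * x i‖ * w ≤ 4 * K → e ∈ relationLattice x := by
    refine (Filter.eventually_all_finite (finite_abs_le n K)).2 fun e _ => ?_
    by_cases he : ∑ i, (e i : ℂ) * x i = 0
    · exact Filter.Eventually.of_forall fun _ _ => he
    · have ht := (tendsto_natCast_atTop_atTop (R := ℝ)).const_mul_atTop (norm_pos_iff.2 he)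
      filter_upwards [ht.eventually_gt_atTop (4 * K)] with w hw hle
      exact absurd hle hw.not_ge
  filter_upwards [hlarge, Filter.eventually_gt_atTop 0] with w hw hpos s s' hs' hstep
  rintro ⟨v, hv, hvx⟩
  subst hs'
  have h := hK s s' hpos hstep v hv
  exact hvx (hw v.1 h.1 h.2)

end Algorithm

end IntegerRelation

/-- The algorithm is correct and terminates: whichever admissible approximations and
LLL-reduced bases are used, it never gets stuck, it does not run forever, and what it returns is a
basis of the lattice of integer relations. -/
theorem mainTheorem6 (n : ℕ) (x : Fin n → ℂ) (hx : ∀ i, x i ≠ 0) (M : ℚ)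
    (hM : ∃ S : Set (Fin n → ℤ),
      IntegerRelation.IsLatticeBasis (IntegerRelation.relationLattice x) S ∧
        ∀ b ∈ S, ‖b‖ ≤ (M : ℝ)) :
    (∀ s, IntegerRelation.Reachable x M s → IntegerRelation.LoopCond x s →
        ∃ s', IntegerRelation.Step x M s s') ∧
    (¬ ∃ s : ℕ → IntegerRelation.State n, s 0 = IntegerRelation.State.init n ∧
        ∀ k, IntegerRelation.Step x M (s k) (s (k + 1))) ∧
    (∀ s, IntegerRelation.Reachable x M s → ¬ IntegerRelation.LoopCond x s →
        IntegerRelation.IsLatticeBasis (IntegerRelation.relationLattice x) s.output) := by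
  obtain ⟨S, ⟨-, hS⟩, hSM⟩ := hM
  refine ⟨fun s hs => (IntegerRelation.invariant_of_reachable hS hSM hs).exists_step M, ?_,
    fun s hs => (IntegerRelation.invariant_of_reachable hS hSM hs).isLatticeBasis⟩
  rintro ⟨s, h0, hstep⟩
  have hw : ∀ k, (s k).w = 2 ^ k := fun k => by
    induction k with
    | zero => rw [h0]; rfl
    | succ k ih => rw [(hstep k).2.1, ih, pow_succ, mul_comm]
  have ht : Filter.Tendsto (fun k : ℕ => 2 ^ (k + 1)) Filter.atTop (Filter.atTop (α := ℕ)) :=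
    (tendsto_pow_atTop_atTop_of_one_lt one_lt_two).comp (Filter.tendsto_add_atTop_nat 1)
  obtain ⟨k, hk⟩ := (ht.eventually (IntegerRelation.eventually_not_loopCond x M)).exists
  -- Step `k` falsifies the loop condition that step `k + 1` requires.
  exact hk (s k) (s (k + 1)) (hw (k + 1)) (hstep k) (hstep (k + 1)).1
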